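/- Let $\mathcal V$ be a countably infinite set of names and let $\mathfrak S(\mathcal V)$ be the group of permutations of $\mathcal V$ generated by the transpositions. A nominal set is a set with an action of $\mathfrak S(\mathcal V)$ in which every element $x$ is supported by some finite $S\subseteq\mathcal V$ (every $\pi$ fixing $S$ pointwise satisfies $\pi\cdot x=x$); $\mathsf{Nom}$ is the category of nominal sets and equivariant maps, $0$ is its initial object (the empty nominal set) and $1$ its terminal object (the one-point nominal set). An equivariant metric on a nominal set $X$ is a metric $d:X\times X\to[0,1]$ with $d(\pi\cdot x,\pi\cdot y)=d(x,y)$ for all $\pi,x,y$. A finitely supported Cauchy sequence is a Cauchy sequence all of whose members are supported by one common finite set $S\subseteq\mathcal V$. A nominal set $Y$ with an equivariant metric is the nominal completion of a nominal set $X$ with an equivariant metric, via an equivariant map $i:X\to Y$, if $i$ is an isometric embedding, every finitely supported Cauchy sequence in $Y$ converges in $Y$, and every $y\in Y$ is the limit of $(i(x_n))_n$ for some finitely supported Cauchy sequence $(x_n)_n$ in $X$. **Theorem.** Let $F:\mathsf{Nom}\to\mathsf{Nom}$ be a functor that preserves limits of $\omega^{\mathrm{op}}$-chains and monomorphisms,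 and suppose that there is a morphism $1\to F0$ in $\mathsf{Nom}$. Then $F$ has a final coalgebra $t:T\to FT$ and an initial algebra $a:FI\to I$, and both $T$ and $I$ can be equipped with equivariant metrics such that $T$ is the nominal completion of $I$ via the canonical equivariant map $i:I\to T$, i.e. the map with $t\circ i\circ a=F i$. Moreover the metric on $T$ can be taken to be $$d(x,y)=2^{-\max\{n\,\mid\,p_n(x)=p_n(y)\}}\qquad(\text{with } d(x,y)=0 \text{ if } p_n(x)=p_n(y)\text{ for all }n),$$ where $p_n:T\to F^n1$ are the projections to the final chain: $p_0:T\to1$ is the unique map and $p_{n+1}=Fp_n\circ t$; the metric on $I$ is then the one induced by $i$. -/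

import Mathlib

open CategoryTheory Filter Topology

universe u v

/-- The group of permutations of `V` generated by the transpositions. -/
def FinPerm (V : Type u) : Subgroup (Equiv.Perm V) := by
  classical exact Subgroup.closure {σ : Equiv.Perm V | σ.IsSwap}

/-- A nominal set over the set of names `V`: a set with an action of the group `FinPerm V`
such that every element is supported by a finite set of names. -/
structure Nom (V : Type u) where
  carrier : Type v
  [action : MulAction (FinPerm V) carrier]
  finitely_supported : ∀ x : carrier, ∃ S : Finset V, MulAction.Supports (FinPerm V) (S : Set V) x

namespace Nom

variable {V : Type u}

instance : CoeSort (Nom.{u, v} V) (Type v) := ⟨Nom.carrier⟩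

instance (X : Nom.{u, v} V) : MulAction (FinPerm V) X := X.action

/-- The category of nominal sets and equivariant maps. -/
instance : Category.{v} (Nom.{u, v} V) where
  Hom X Y := X →[FinPerm V] Y
  id X := MulActionHom.id (FinPerm V)
  comp f g := MulActionHom.comp g f

instance : ConcreteCategory (Nom.{u, v} V) (fun X Y => X →[FinPerm V] Y) where
  hom f := f
  ofHom f := f

/-- The one-point nominal set. -/
def one (V : Type u) : Nom.{u, v} V where
  carrier := PUnit.{v + 1}
  action := { smul := fun _ x => x, one_smul := fun _ => rfl, mul_smul := fun _ _ _ => rfl }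
  finitely_supported _ := ⟨∅, fun _ _ => rfl⟩

/-- The empty nominal set. -/
def zero (V : Type u) : Nom.{u, v} V where
  carrier := PEmpty.{v + 1}
  action := { smul := fun _ x => x, one_smul := fun _ => rfl, mul_smul := fun _ _ _ => rfl }
  finitely_supported x := x.elim

/-- The unique morphism into the one-point nominal set. -/
def toOne (X : Nom.{u, v} V) : X ⟶ one V :=
  (⟨fun _ => PUnit.unit, fun _ _ => rfl⟩ : X →[FinPerm V] (one V : Nom.{u, v} V))

/-- The unique morphism out of the empty nominal set. -/
def fromZero (X : Nom.{u, v} V) : zero V ⟶ X :=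
  (⟨fun x => PEmpty.elim x, fun _ x => PEmpty.elim x⟩ : (zero V : Nom.{u, v} V) →[FinPerm V] X)

/-- The one-point nominal set is the terminal object `1`. -/
def oneIsTerminal : Limits.IsTerminal (one V : Nom.{u, v} V) :=
  Limits.IsTerminal.ofUniqueHom toOne fun _ _ => MulActionHom.ext fun _ => rfl

/-- The empty nominal set is the initial object `0`. -/
def zeroIsInitial : Limits.IsInitial (zero V : Nom.{u, v} V) :=
  Limits.IsInitial.ofUniqueHom fromZero fun _ _ => MulActionHom.ext fun x => PEmpty.elim x

/-- An equivariant metric on a nominal set `X`: a metric `X × X → [0,1]` which is invariant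
under the action. With it, `X` is a nominal metric space. -/
class EquivariantMetric (X : Nom.{u, v} V) extends MetricSpace X where
  dist_le_one : ∀ x y : X, dist x y ≤ 1
  dist_smul_smul : ∀ (π : FinPerm V) (x y : X), dist (π • x) (π • y) = dist x y

/-- A finitely supported Cauchy sequence: a Cauchy sequence all of whose members are supported
by one and the same finite set of names. -/
def IsFSCauchySeq {X : Nom.{u, v} V} [EquivariantMetric X] (x : ℕ → X) : Prop :=
  CauchySeq x ∧ ∃ S : Finset V, ∀ n, MulAction.Supports (FinPerm V) (S : Set V) (x n)

/-- A nominal metric space is complete when every finitely supported Cauchy sequence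
converges. -/
def IsNominallyComplete (X : Nom.{u, v} V) [EquivariantMetric X] : Prop :=
  ∀ x : ℕ → X, IsFSCauchySeq x → ∃ y : X, Tendsto x atTop (𝓝 y)

/-- The morphism `i : X ⟶ Y` exhibits `Y` as the nominal completion of `X`: it embeds `X`
isometrically in the complete nominal metric space `Y`, and the points of `Y` are the limits of
the finitely supported Cauchy sequences of `X`. -/
structure IsNominalCompletion {X Y : Nom.{u, v} V} [EquivariantMetric X] [EquivariantMetric Y]
    (i : X ⟶ Y) : Prop where
  isometry : Isometry fun x : X => i x
  complete : IsNominallyComplete Y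
  exists_seq : ∀ y : Y, ∃ x : ℕ → X, IsFSCauchySeq x ∧ Tendsto (fun n => i (x n)) atTop (𝓝 y)

variable (F : Nom.{u, v} V ⥤ Nom.{u, v} V)

/-- The objects `F^n 1` of the final chain of `F`. -/
def finalChain : ℕ → Nom.{u, v} V
  | 0 => one V
  | n + 1 => F.obj (finalChain n)

variable {F}

/-- The canonical projections `p_n : T ⟶ F^n 1` of a coalgebra `t : T ⟶ F T` to the final chain:
`p_0` is the unique map to `1`, and `p_{n+1} = F p_n ∘ t`. -/
def proj (T : Endofunctor.Coalgebra F) : (n : ℕ) → (T.V ⟶ finalChain F n)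
  | 0 => toOne T.V
  | n + 1 => T.str ≫ F.map (proj T n)

/-- `chainDist T x y = 2 ^ (- max {n | p_n x = p_n y})`, which is `0` if `p_n x = p_n y` for
all `n`. (The infimum is over a nonempty set of positive numbers, as `n = 0` always qualifies.) -/
noncomputable def chainDist (T : Endofunctor.Coalgebra F) (x y : T.V) : ℝ :=
  sInf {r : ℝ | ∃ n : ℕ, proj T n x = proj T n y ∧ r = (1 / 2 : ℝ) ^ n}

end Nom

/-! The limit of an `ω^op`-chain in nominal sets consists of the finitely supported threads. Since
`F` preserves it, the limit `T` of the chain `F^n 1` is the final coalgebra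
(`finalCoalgebraIsTerminal`), and `t` is invertible.

The initial algebra is found inside `T`, not as a colimit, since `F` need not preserve colimits: it
is the least equivariant subset closed under the injection `m = t⁻¹ : F T ⟶ T`. Uniqueness of
morphisms out of it is induction; existence is Zorn's lemma on partial morphisms, using that `F`
preserves monomorphisms (`exists_leastStr_hom`).

In the ultrametric `chainDist`, a Cauchy sequence stabilises at each level of the chain, and a
common support makes the limiting thread finitely supported, so `T` is complete. For density, a
point `1 ⟶ F 0` yields maps `F^n 1 ⟶ I` that are sections of `p_n ∘ i` (`chainSection_comp_proj`).
Applied to `p_n y`, they give a sequence in `I` tending to `y` and supported by any support of `y`.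
-/

namespace Nom

variable {V : Type u}

/-! ### Supports, equivariant subsets and monomorphisms. -/

theorem hom_ext {X Y : Nom.{u, v} V} {f g : X ⟶ Y} (h : ∀ x, f x = g x) : f = g :=
  MulActionHom.ext h

/-- If `k` fixes `g • S` pointwise, then `g⁻¹ * k * g` fixes `S` pointwise. -/
theorem supports_smul {X : Nom.{u, v} V} [DecidableEq V] {S : Finset V} {x : X}
    (h : MulAction.Supports (FinPerm V) (S : Set V) x) (g : FinPerm V) :
    MulAction.Supports (FinPerm V) ((S.image fun a => g • a : Finset V) : Set V) (g • x) := by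
  intro k hk
  have h1 : (g⁻¹ * k * g) • x = x := by
    apply h
    intro a ha
    have h2 : k • g • a = g • a := by
      apply hk
      simp only [Finset.coe_image]
      exact ⟨a, ha, rfl⟩
    rw [mul_smul, mul_smul, h2, inv_smul_smul]
  rw [mul_smul, mul_smul, inv_smul_eq_iff] at h1
  exact h1

theorem supports_map {X Y : Nom.{u, v} V} (f : X ⟶ Y) {S : Set V} {x : X}
    (h : MulAction.Supports (FinPerm V) S x) : MulAction.Supports (FinPerm V) S (f x) := by
  intro k hk
  rw [← map_smul, h k hk]

/-- The nominal set on an equivariant subset. -/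
def sub {X : Nom.{u, v} V} (S : SubMulAction (FinPerm V) X) : Nom.{u, v} V where
  carrier := S
  finitely_supported x := by
    obtain ⟨A, hA⟩ := X.finitely_supported x.1
    exact ⟨A, fun k hk => Subtype.ext (hA k hk)⟩

/-- The inclusion of an equivariant subset. -/
def incl {X : Nom.{u, v} V} (S : SubMulAction (FinPerm V) X) : sub S ⟶ X :=
  S.subtype

/-- The inclusion between two nested equivariant subsets. -/
def inclOfLE {X : Nom.{u, v} V} {S T : SubMulAction (FinPerm V) X} (h : S ≤ T) :
    sub S ⟶ sub T :=
  ({ toFun := fun x => ⟨x.1, h x.2⟩, map_smul' := fun _ _ => rfl } :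
    S →[FinPerm V] T)

theorem incl_injective {X : Nom.{u, v} V} (S : SubMulAction (FinPerm V) X) :
    Function.Injective (incl S) :=
  Subtype.val_injective

theorem inclOfLE_comp_incl {X : Nom.{u, v} V} {S T : SubMulAction (FinPerm V) X} (h : S ≤ T) :
    inclOfLE h ≫ incl T = incl S :=
  rfl

/-- The factorization of a morphism through an injective one. -/
noncomputable def factor {X Y Z : Nom.{u, v} V} (g : X ⟶ Y) (m : Z ⟶ Y)
    (hm : Function.Injective m) (h : ∀ x, ∃ z, m z = g x) : X ⟶ Z :=
  ({ toFun := fun x => (h x).choose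
     map_smul' := fun k x => hm (by
      rw [(h (k • x)).choose_spec]
      change g (k • x) = m (k • (h x).choose)
      rw [map_smul, map_smul, (h x).choose_spec]) } : X →[FinPerm V] Z)

theorem factor_apply {X Y Z : Nom.{u, v} V} (g : X ⟶ Y) (m : Z ⟶ Y)
    (hm : Function.Injective m) (h : ∀ x, ∃ z, m z = g x) (x : X) : m (factor g m hm h x) = g x :=
  (h x).choose_spec

theorem factor_comp {X Y Z : Nom.{u, v} V} (g : X ⟶ Y) (m : Z ⟶ Y)
    (hm : Function.Injective m) (h : ∀ x, ∃ z, m z = g x) : factor g m hm h ≫ m = g :=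
  hom_ext (factor_apply g m hm h)

theorem mono_of_injective {X Y : Nom.{u, v} V} (f : X ⟶ Y) (h : Function.Injective f) : Mono f where
  right_cancellation g k hgk := hom_ext fun x => h (by
    rw [← ConcreteCategory.comp_apply, hgk, ConcreteCategory.comp_apply])

/-- The binary product of nominal sets. -/
def prod (X Y : Nom.{u, v} V) : Nom.{u, v} V where
  carrier := X × Y
  finitely_supported x := by
    classical
    obtain ⟨A, hA⟩ := X.finitely_supported x.1
    obtain ⟨B, hB⟩ := Y.finitely_supported x.2
    exact ⟨A ∪ B, fun k hk => Prod.ext (hA k fun a ha => hk (by simp_all))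
      (hB k fun a ha => hk (by simp_all))⟩

/-- The kernel pair of `f` is itself a nominal set; `f` equalises its two projections, so they
coincide. -/
theorem injective_of_mono {X Y : Nom.{u, v} V} (f : X ⟶ Y) [Mono f] : Function.Injective f := by
  intro x y hxy
  let K : SubMulAction (FinPerm V) (prod X X) :=
    { carrier := {p : X × X | f p.1 = f p.2}
      smul_mem' := fun k (p : X × X) (hp : f p.1 = f p.2) => by
        change f (k • p.1) = f (k • p.2)
        rw [map_smul, map_smul, hp] }
  let p₁ : sub K ⟶ X :=
    ({ toFun := fun p => p.1.1, map_smul' := fun _ _ => rfl } : K →[FinPerm V] X)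
  let p₂ : sub K ⟶ X :=
    ({ toFun := fun p => p.1.2, map_smul' := fun _ _ => rfl } : K →[FinPerm V] X)
  have h : p₁ = p₂ := (cancel_mono f).1 (hom_ext fun p => p.2)
  exact congrArg (fun q : sub K ⟶ X => q (⟨(x, y), hxy⟩ : K)) h

theorem map_injective (F : Nom.{u, v} V ⥤ Nom.{u, v} V) [F.PreservesMonomorphisms]
    {X Y : Nom.{u, v} V} (f : X ⟶ Y) (h : Function.Injective f) :
    Function.Injective (F.map f) := by
  have := mono_of_injective f h
  exact injective_of_mono _

/-- The range of a morphism, as an equivariant subset. -/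
def range {X Y : Nom.{u, v} V} (f : X ⟶ Y) : SubMulAction (FinPerm V) Y where
  carrier := Set.range f
  smul_mem' := by
    rintro k _ ⟨x, rfl⟩
    exact ⟨k • x, map_smul _ _ _⟩

/-! ### The initial algebra as a least closed subset. -/

section InitialAlgebra

variable {F : Nom.{u, v} V ⥤ Nom.{u, v} V} {A : Nom.{u, v} V} (m : F.obj A ⟶ A)

/-- The image of `F S` under `F S ⟶ F A ⟶ A`, for an equivariant subset `S` of `A`. -/
def step (S : SubMulAction (FinPerm V) A) : SubMulAction (FinPerm V) A :=
  range (F.map (incl S) ≫ m)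

theorem mem_step {S : SubMulAction (FinPerm V) A} {x : A} :
    x ∈ step m S ↔ ∃ z, m (F.map (incl S) z) = x :=
  Iff.rfl

theorem map_inclOfLE {S T : SubMulAction (FinPerm V) A} (h : S ≤ T) (z : F.obj (sub S)) :
    F.map (incl T) (F.map (inclOfLE h) z) = F.map (incl S) z := by
  rw [← ConcreteCategory.comp_apply, ← F.map_comp, inclOfLE_comp_incl]

theorem step_mono {S T : SubMulAction (FinPerm V) A} (h : S ≤ T) : step m S ≤ step m T := by
  rintro _ ⟨z, rfl⟩
  refine ⟨F.map (inclOfLE h) z, ?_⟩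
  rw [ConcreteCategory.comp_apply, ConcreteCategory.comp_apply, map_inclOfLE]

/-- The least equivariant subset of `A` closed under `step m`. -/
def leastClosed : SubMulAction (FinPerm V) A :=
  sInf {S | step m S ≤ S}

theorem leastClosed_le {S : SubMulAction (FinPerm V) A} (h : step m S ≤ S) : leastClosed m ≤ S :=
  sInf_le h

theorem step_leastClosed_le : step m (leastClosed m) ≤ leastClosed m :=
  le_sInf fun _ hS => (step_mono m (leastClosed_le m hS)).trans hS

/-- The algebra structure on the least closed subset. -/
noncomputable def leastStr : F.obj (sub (leastClosed m)) ⟶ sub (leastClosed m) :=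
  factor (F.map (incl (leastClosed m)) ≫ m) (incl (leastClosed m)) (incl_injective _)
    fun z => ⟨(⟨_, step_leastClosed_le m ⟨z, rfl⟩⟩ : leastClosed m), rfl⟩

theorem leastStr_comp_incl :
    leastStr m ≫ incl (leastClosed m) = F.map (incl (leastClosed m)) ≫ m :=
  factor_comp _ _ (incl_injective _) _

theorem leastStr_val (z : F.obj (sub (leastClosed m))) :
    (leastStr m z).1 = m (F.map (incl (leastClosed m)) z) :=
  congrArg (fun q : F.obj (sub (leastClosed m)) ⟶ A => q z) (leastStr_comp_incl m)

/-- Induction: the equaliser of `f` and `g` is closed under `step m`, hence contains `leastClosed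
m`. -/
theorem leastStr_hom_unique {B : Nom.{u, v} V} (b : F.obj B ⟶ B) (f g : sub (leastClosed m) ⟶ B)
    (hf : F.map f ≫ b = leastStr m ≫ f) (hg : F.map g ≫ b = leastStr m ≫ g) : f = g := by
  let E : SubMulAction (FinPerm V) A :=
    { carrier := {x | ∃ hx : x ∈ leastClosed m,
        f (⟨x, hx⟩ : leastClosed m) = g (⟨x, hx⟩ : leastClosed m)}
      smul_mem' := by
        rintro k x ⟨hx, h⟩
        refine ⟨(leastClosed m).smul_mem k hx, ?_⟩
        let y : sub (leastClosed m) := (⟨x, hx⟩ : leastClosed m)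
        change f (k • y) = g (k • y)
        rw [map_smul, map_smul]
        exact congrArg (k • ·) h }
  have hE : E ≤ leastClosed m := fun x hx => hx.1
  have hfg : inclOfLE hE ≫ f = inclOfLE hE ≫ g := hom_ext fun x => x.2.2
  have key : step m E ≤ E := by
    rintro _ ⟨z, rfl⟩
    have hmem := step_leastClosed_le m (step_mono m hE ((mem_step m).2 ⟨z, rfl⟩))
    have hz : leastStr m (F.map (inclOfLE hE) z) =
        (⟨m (F.map (incl E) z), hmem⟩ : leastClosed m) := by
      apply Subtype.ext
      rw [leastStr_val, map_inclOfLE]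
    refine ⟨hmem, ?_⟩
    have h1 : F.map (inclOfLE hE) ≫ leastStr m ≫ f = F.map (inclOfLE hE) ≫ leastStr m ≫ g := by
      rw [← hf, ← hg, ← F.map_comp_assoc, ← F.map_comp_assoc, hfg]
    have h2 := congrArg (fun q : F.obj (sub E) ⟶ B => q z) h1
    simp only [ConcreteCategory.comp_apply] at h2
    rw [hz] at h2
    exact h2
  exact hom_ext fun x => (leastClosed_le m key x.2).2

/-- The least closed subset as an algebra. -/
noncomputable def leastAlgebra : Endofunctor.Algebra F where
  a := sub (leastClosed m)
  str := leastStr m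

/-- A coalgebra-to-algebra morphism into `B`, defined on an equivariant subset of `A`. -/
structure PartialHom (B : Endofunctor.Algebra F) where
  /-- the domain -/
  dom : SubMulAction (FinPerm V) A
  le_step : dom ≤ step m dom
  /-- the morphism -/
  hom : sub dom ⟶ B.a
  -- For injective `m` and mono-preserving `F`, the `z` provided by `le_step` is unique, so no
  -- coalgebra map on `dom` need be stored.
  comm : ∀ (z : F.obj (sub dom)) (x : dom), m (F.map (incl dom) z) = x.1 →
    hom x = B.str (F.map hom z)

namespace PartialHom

variable {m} {B : Endofunctor.Algebra F}

/-- `Q` extends `P`. -/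
def Extends (P Q : PartialHom m B) : Prop :=
  ∃ h : P.dom ≤ Q.dom, inclOfLE h ≫ Q.hom = P.hom

theorem Extends.apply {P Q : PartialHom m B} (h : Extends P Q) (x : A) (hP : x ∈ P.dom)
    (hQ : x ∈ Q.dom) : Q.hom (⟨x, hQ⟩ : Q.dom) = P.hom (⟨x, hP⟩ : P.dom) := by
  obtain ⟨h, e⟩ := h
  exact congrArg (fun q : sub P.dom ⟶ B.a => q (⟨x, hP⟩ : P.dom)) e

theorem Extends.trans {P Q R : PartialHom m B} (h : Extends P Q) (h' : Extends Q R) :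
    Extends P R :=
  ⟨h.1.trans h'.1, hom_ext fun x =>
    (h'.apply x.1 (h.1 x.2) (h'.1 (h.1 x.2))).trans (h.apply x.1 x.2 (h.1 x.2))⟩

/-- Injectivity of `F.map (incl P.dom) ≫ m` lets each point of its image be decoded uniquely;
decoding, then `F.map P.hom`, then `B.str` defines the extension. -/
theorem exists_extends_step [F.PreservesMonomorphisms] (hm : Function.Injective m)
    (P : PartialHom m B) : ∃ Q : PartialHom m B, Extends P Q ∧ Q.dom = step m P.dom := by
  have hinj : Function.Injective (F.map (incl P.dom) ≫ m) := by
    intro x y hxy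
    rw [ConcreteCategory.comp_apply, ConcreteCategory.comp_apply] at hxy
    exact map_injective F _ (incl_injective _) (hm hxy)
  let σ : sub (step m P.dom) ⟶ F.obj (sub P.dom) :=
    factor (incl (step m P.dom)) (F.map (incl P.dom) ≫ m) hinj fun x => x.2
  have hσ : ∀ (z : F.obj (sub P.dom)) (x : step m P.dom),
      m (F.map (incl P.dom) z) = x.1 → σ x = z := by
    intro z x hx
    apply hinj
    refine (factor_apply (incl (step m P.dom)) _ hinj _ x).trans ?_
    rw [ConcreteCategory.comp_apply, hx]
    rfl
  let h' : sub (step m P.dom) ⟶ B.a := σ ≫ F.map P.hom ≫ B.str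
  have hext : inclOfLE P.le_step ≫ h' = P.hom := by
    apply hom_ext
    intro x
    obtain ⟨z, hz⟩ := P.le_step x.2
    rw [P.comm z x hz]
    exact congrArg (fun w => B.str (F.map P.hom w)) (hσ z (inclOfLE P.le_step x) hz)
  refine ⟨⟨step m P.dom, step_mono m P.le_step, h', ?_⟩, ⟨P.le_step, hext⟩, rfl⟩
  intro z' x hx
  obtain ⟨z, hz⟩ := x.2
  -- A preimage of `x` over the larger domain already comes from `F` of the smaller one.
  have hz' : z' = F.map (inclOfLE P.le_step) z := by
    apply map_injective F _ (incl_injective _)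
    apply hm
    rw [hx, map_inclOfLE]
    exact hz.symm
  refine (congrArg (fun w => B.str (F.map P.hom w)) (hσ z x hz)).trans ?_
  rw [hz', ← ConcreteCategory.comp_apply (F.map _) (F.map h'), ← F.map_comp, hext]

/-- Members of a chain agree on overlaps, so they glue on the union of their domains. `F` need not
preserve this union: each point lies in some `P.dom`, and its decoding comes from `F` of that
domain. -/
theorem exists_chain_bound [F.PreservesMonomorphisms] (hm : Function.Injective m)
    (c : Set (PartialHom m B)) (hc : IsChain Extends c) :
    ∃ Q : PartialHom m B, ∀ P ∈ c, Extends P Q := by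
  let U : SubMulAction (FinPerm V) A :=
    { carrier := {x | ∃ P ∈ c, x ∈ P.dom}
      smul_mem' := fun k x ⟨P, hP, hx⟩ => ⟨P, hP, P.dom.smul_mem k hx⟩ }
  have hU : ∀ P ∈ c, P.dom ≤ U := fun P hP x hx => ⟨P, hP, hx⟩
  have hcompat : ∀ P ∈ c, ∀ Q ∈ c, ∀ (x : A) (hP : x ∈ P.dom) (hQ : x ∈ Q.dom),
      P.hom (⟨x, hP⟩ : P.dom) = Q.hom (⟨x, hQ⟩ : Q.dom) := by
    intro P hP Q hQ x hxP hxQ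
    rcases eq_or_ne P Q with rfl | hne
    · rfl
    · rcases hc hP hQ hne with h | h
      · exact (h.apply x hxP hxQ).symm
      · exact h.apply x hxQ hxP
  choose p hpc hp using fun x : U => x.2
  have hval : ∀ (P : PartialHom m B) (_ : P ∈ c) (x : U) (hx : x.1 ∈ P.dom),
      (p x).hom (⟨x.1, hp x⟩ : (p x).dom) = P.hom (⟨x.1, hx⟩ : P.dom) :=
    fun P hP x hx => hcompat _ (hpc x) _ hP _ _ _
  let h : sub U ⟶ B.a :=
    ({ toFun := fun x => (p x).hom (⟨x.1, hp x⟩ : (p x).dom)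
       map_smul' := fun k x => by
        rw [hval (p x) (hpc x) (k • x) ((p x).dom.smul_mem k (hp x))]
        let y : sub (p x).dom := (⟨x.1, hp x⟩ : (p x).dom)
        exact map_smul (ConcreteCategory.hom (p x).hom) k y } : U →[FinPerm V] B.a)
  have hext : ∀ P (hP : P ∈ c), inclOfLE (hU P hP) ≫ h = P.hom := fun P hP =>
    hom_ext fun x => hval P hP ⟨x.1, hU P hP x.2⟩ x.2
  refine ⟨⟨U, ?_, h, ?_⟩, fun P hP => ⟨hU P hP, hext P hP⟩⟩
  · rintro x ⟨P, hP, hx⟩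
    exact step_mono m (hU P hP) (P.le_step hx)
  · intro z x hx
    obtain ⟨P, hP, hxP⟩ := x.2
    obtain ⟨z', hz'⟩ := P.le_step hxP
    have hz : z = F.map (inclOfLE (hU P hP)) z' := by
      apply map_injective F _ (incl_injective _)
      apply hm
      rw [hx, map_inclOfLE]
      exact hz'.symm
    rw [hz, ← ConcreteCategory.comp_apply (F.map _) (F.map h), ← F.map_comp, hext P hP,
      ← P.comm z' ⟨x.1, hxP⟩ hz']
    exact hval P hP x hxP

end PartialHom

/-- A maximal partial morphism has a domain closed under `step m`, since its one-step extension adds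
nothing; it therefore restricts to `leastClosed m`. -/
theorem exists_leastStr_hom [F.PreservesMonomorphisms] (hm : Function.Injective m)
    (B : Endofunctor.Algebra F) :
    ∃ f : sub (leastClosed m) ⟶ B.a, F.map f ≫ B.str = leastStr m ≫ f := by
  obtain ⟨P, hP⟩ := exists_maximal_of_chains_bounded
    (PartialHom.exists_chain_bound (B := B) hm) PartialHom.Extends.trans
  obtain ⟨Q, hPQ, hQ⟩ := P.exists_extends_step hm
  have hle : leastClosed m ≤ P.dom := leastClosed_le m (hQ ▸ (hP Q hPQ).1)
  refine ⟨inclOfLE hle ≫ P.hom, hom_ext fun z => ?_⟩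
  rw [F.map_comp]
  refine Eq.symm (P.comm (F.map (inclOfLE hle) z) (inclOfLE hle (leastStr m z)) ?_)
  rw [map_inclOfLE]
  exact (leastStr_val m z).symm

/-- The least closed subset of an algebra with injective structure is the initial algebra. -/
noncomputable def leastAlgebraIsInitial [F.PreservesMonomorphisms] (hm : Function.Injective m) :
    Limits.IsInitial (leastAlgebra m) :=
  Limits.IsInitial.ofUniqueHom
    (fun B => ⟨(exists_leastStr_hom m hm B).choose, (exists_leastStr_hom m hm B).choose_spec⟩)
    fun B f => Endofunctor.Algebra.ext (leastStr_hom_unique m B.str _ _ f.h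
      (exists_leastStr_hom m hm B).choose_spec)

end InitialAlgebra

/-! ### Limits of sequences of nominal sets. -/

section SequentialLimit

variable {X : ℕ → Nom.{u, v} V} (c : ∀ n, X (n + 1) ⟶ X n)

/-- The limit of a sequence of nominal sets: the finitely supported threads. -/
def seqLimit : Nom.{u, v} V where
  carrier := {x : ∀ n, X n // (∀ n, c n (x (n + 1)) = x n) ∧
    ∃ S : Finset V, ∀ n, MulAction.Supports (FinPerm V) (S : Set V) (x n)}
  action :=
    { smul := fun k x => ⟨fun n => k • x.1 n, fun n => by rw [map_smul, x.2.1], by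
        classical
        obtain ⟨S, hS⟩ := x.2.2
        exact ⟨_, fun n => supports_smul (hS n) k⟩⟩
      one_smul := fun x => Subtype.ext (funext fun n => one_smul _ (x.1 n))
      mul_smul := fun k l x => Subtype.ext (funext fun n => mul_smul k l (x.1 n)) }
  finitely_supported x := by
    obtain ⟨S, hS⟩ := x.2.2
    exact ⟨S, fun k hk => Subtype.ext (funext fun n => hS n k hk)⟩

/-- The projections of the limit of a sequence. -/
def seqLimitProj (n : ℕ) : seqLimit c ⟶ X n where
  toFun x := x.1 n
  map_smul' _ _ := rfl

theorem seqLimitProj_comp (n : ℕ) : seqLimitProj c (n + 1) ≫ c n = seqLimitProj c n :=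
  hom_ext fun x => x.2.1 n

theorem seqLimit_ext {x y : seqLimit c} (h : ∀ n, seqLimitProj c n x = seqLimitProj c n y) :
    x = y :=
  Subtype.ext (funext h)

/-- The morphism into the limit of a sequence induced by a compatible family. -/
def seqLimitLift {W : Nom.{u, v} V} (w : ∀ n, W ⟶ X n) (hw : ∀ n, w (n + 1) ≫ c n = w n) :
    W ⟶ seqLimit c where
  toFun x := ⟨fun n => w n x, fun n => by rw [← ConcreteCategory.comp_apply, hw], by
    -- By equivariance, one support of `x` serves all components of the thread.
    obtain ⟨S, hS⟩ := W.finitely_supported x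
    exact ⟨S, fun n => supports_map (w n) hS⟩⟩
  map_smul' k x := Subtype.ext (funext fun n => map_smul (ConcreteCategory.hom (w n)) k x)

theorem seqLimitLift_comp {W : Nom.{u, v} V} (w : ∀ n, W ⟶ X n)
    (hw : ∀ n, w (n + 1) ≫ c n = w n) (n : ℕ) :
    seqLimitLift c w hw ≫ seqLimitProj c n = w n :=
  rfl

/-- The limit of a sequence as a cone. -/
def seqCone : Limits.Cone (Functor.ofOpSequence c) where
  pt := seqLimit c
  π := NatTrans.ofOpSequence (G := Functor.ofOpSequence c) (seqLimitProj c) fun n => by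
    rw [Functor.ofOpSequence_map_homOfLE_succ]
    exact (Category.id_comp _).trans (seqLimitProj_comp c n).symm

/-- The finitely supported threads form the limit. -/
def seqConeIsLimit : Limits.IsLimit (seqCone c) where
  lift s := seqLimitLift c (fun n => s.π.app ⟨n⟩) fun n => by
    have h := s.w (homOfLE (Nat.le_add_right n 1)).op
    rw [Functor.ofOpSequence_map_homOfLE_succ] at h
    exact h
  fac _ _ := rfl
  uniq s f h := hom_ext fun x => seqLimit_ext c fun n =>
    congrArg (fun q : s.pt ⟶ X n => q x) (h ⟨n⟩)

variable (F : Nom.{u, v} V ⥤ Nom.{u, v} V) [Limits.PreservesLimitsOfShape ℕᵒᵖ F]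

theorem map_seqLimit_hom_ext {W : Nom.{u, v} V} {f g : W ⟶ F.obj (seqLimit c)}
    (h : ∀ n, f ≫ F.map (seqLimitProj c n) = g ≫ F.map (seqLimitProj c n)) : f = g :=
  (Limits.isLimitOfPreserves F (seqConeIsLimit c)).hom_ext fun n => h n.unop

theorem exists_map_seqLimit_lift {W : Nom.{u, v} V} (w : ∀ n, W ⟶ F.obj (X n))
    (hw : ∀ n, w (n + 1) ≫ F.map (c n) = w n) :
    ∃ f : W ⟶ F.obj (seqLimit c), ∀ n, f ≫ F.map (seqLimitProj c n) = w n := by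
  let s : Limits.Cone (Functor.ofOpSequence c ⋙ F) :=
    { pt := W
      π := NatTrans.ofOpSequence (F := (Functor.const ℕᵒᵖ).obj W)
        (G := Functor.ofOpSequence c ⋙ F) w fun n => by
          rw [Functor.comp_map, Functor.ofOpSequence_map_homOfLE_succ]
          exact (Category.id_comp _).trans (hw n).symm }
  exact ⟨(Limits.isLimitOfPreserves F (seqConeIsLimit c)).lift s, fun n =>
    (Limits.isLimitOfPreserves F (seqConeIsLimit c)).fac s ⟨n⟩⟩

end SequentialLimit

/-! ### The final coalgebra as the limit of the final chain. -/

section FinalCoalgebra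

variable (F : Nom.{u, v} V ⥤ Nom.{u, v} V)

/-- The connecting morphisms `F^(n+1) 1 ⟶ F^n 1` of the final chain. -/
def chainMap : (n : ℕ) → (finalChain F (n + 1) ⟶ finalChain F n)
  | 0 => toOne _
  | n + 1 => F.map (chainMap n)

variable {F}

theorem proj_comp_chainMap (T : Endofunctor.Coalgebra F) (n : ℕ) :
    proj T (n + 1) ≫ chainMap F n = proj T n := by
  induction n with
  | zero => rfl
  | succ n ih =>
    change (T.str ≫ F.map (proj T (n + 1))) ≫ F.map (chainMap F n) = T.str ≫ F.map (proj T n)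
    rw [Category.assoc, ← F.map_comp, ih]

/-- This forces uniqueness of morphisms into the final coalgebra, whose points the projections
separate. -/
theorem hom_comp_proj {C T : Endofunctor.Coalgebra F} (h : C ⟶ T) (n : ℕ) :
    h.f ≫ proj T n = proj C n := by
  induction n with
  | zero => rfl
  | succ n ih =>
    change h.f ≫ T.str ≫ F.map (proj T n) = C.str ≫ F.map (proj C n)
    rw [← Endofunctor.Coalgebra.Hom.h_assoc, ← F.map_comp, ih]

variable (F)

variable [Limits.PreservesLimitsOfShape ℕᵒᵖ F]

theorem exists_finalStr : ∃ t : seqLimit (chainMap F) ⟶ F.obj (seqLimit (chainMap F)),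
    ∀ n, t ≫ F.map (seqLimitProj (chainMap F) n) = seqLimitProj (chainMap F) (n + 1) :=
  exists_map_seqLimit_lift (chainMap F) F (fun n => seqLimitProj (chainMap F) (n + 1))
    fun n => seqLimitProj_comp (chainMap F) (n + 1)

/-- The limit of the final chain, as a coalgebra. -/
noncomputable def finalCoalgebra : Endofunctor.Coalgebra F where
  V := seqLimit (chainMap F)
  str := (exists_finalStr F).choose

theorem proj_finalCoalgebra (n : ℕ) :
    proj (finalCoalgebra F) n = seqLimitProj (chainMap F) n := by
  induction n with
  | zero => rfl
  | succ n ih =>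
    change (exists_finalStr F).choose ≫ F.map (proj (finalCoalgebra F) n) = _
    rw [ih]
    exact (exists_finalStr F).choose_spec n

theorem lift_comp_finalStr (C : Endofunctor.Coalgebra F) :
    C.str ≫ F.map (seqLimitLift (chainMap F) (proj C) (proj_comp_chainMap C)) =
      seqLimitLift (chainMap F) (proj C) (proj_comp_chainMap C) ≫ (exists_finalStr F).choose := by
  apply map_seqLimit_hom_ext (chainMap F) F
  intro n
  rw [Category.assoc, Category.assoc, (exists_finalStr F).choose_spec n, ← F.map_comp,
    seqLimitLift_comp]
  rfl

/-- The limit of the final chain is the final coalgebra. -/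
noncomputable def finalCoalgebraIsTerminal : Limits.IsTerminal (finalCoalgebra F) :=
  Limits.IsTerminal.ofUniqueHom
    (fun C => ⟨seqLimitLift (chainMap F) (proj C) (proj_comp_chainMap C), lift_comp_finalStr F C⟩)
    fun C f => by
      apply Endofunctor.Coalgebra.ext
      apply hom_ext
      intro x
      apply seqLimit_ext (chainMap F)
      intro n
      have h := hom_comp_proj f n
      rw [proj_finalCoalgebra] at h
      exact congrArg (fun q : C.V ⟶ finalChain F n => q x) h

end FinalCoalgebra

/-! ### The ultrametric of the final chain. -/

section ChainMetric

variable {F : Nom.{u, v} V ⥤ Nom.{u, v} V} (T : Endofunctor.Coalgebra F)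

theorem proj_eq_of_le {m n : ℕ} (hmn : m ≤ n) {x y : T.V} (h : proj T n x = proj T n y) :
    proj T m x = proj T m y := by
  induction n, hmn using Nat.le_induction with
  | base => exact h
  | succ n _ ih =>
    apply ih
    rw [← proj_comp_chainMap, ConcreteCategory.comp_apply, h, ← ConcreteCategory.comp_apply]

theorem chainDist_bddBelow (x y : T.V) :
    BddBelow {r : ℝ | ∃ n : ℕ, proj T n x = proj T n y ∧ r = (1 / 2 : ℝ) ^ n} :=
  ⟨0, by rintro _ ⟨n, _, rfl⟩; positivity⟩

theorem chainDist_nonempty (x y : T.V) :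
    {r : ℝ | ∃ n : ℕ, proj T n x = proj T n y ∧ r = (1 / 2 : ℝ) ^ n}.Nonempty :=
  ⟨_, 0, rfl, rfl⟩

theorem chainDist_nonneg (x y : T.V) : 0 ≤ chainDist T x y :=
  le_csInf (chainDist_nonempty T x y) (by rintro _ ⟨n, _, rfl⟩; positivity)

theorem chainDist_le {n : ℕ} {x y : T.V} (h : proj T n x = proj T n y) :
    chainDist T x y ≤ (1 / 2) ^ n :=
  csInf_le (chainDist_bddBelow T x y) ⟨n, h, rfl⟩

theorem exists_of_chainDist_lt {r : ℝ} {x y : T.V} (h : chainDist T x y < r) :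
    ∃ n, proj T n x = proj T n y ∧ (1 / 2 : ℝ) ^ n < r := by
  obtain ⟨_, ⟨n, hn, rfl⟩, hlt⟩ := exists_lt_of_csInf_lt (chainDist_nonempty T x y) h
  exact ⟨n, hn, hlt⟩

theorem proj_eq_of_chainDist_lt {n : ℕ} {x y : T.V} (h : chainDist T x y < (1 / 2) ^ n) :
    proj T n x = proj T n y := by
  obtain ⟨m, hm, hlt⟩ := exists_of_chainDist_lt T h
  refine proj_eq_of_le T (le_of_lt ?_) hm
  exact (pow_lt_pow_iff_right_of_lt_one₀ (by norm_num) (by norm_num)).1 hlt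

theorem chainDist_self (x : T.V) : chainDist T x x = 0 := by
  refine le_antisymm (le_of_forall_pos_le_add fun ε hε => ?_) (chainDist_nonneg T x x)
  obtain ⟨n, hn⟩ := exists_pow_lt_of_lt_one hε (by norm_num : (1 / 2 : ℝ) < 1)
  rw [zero_add]
  exact (chainDist_le T rfl).trans hn.le

theorem chainDist_comm (x y : T.V) : chainDist T x y = chainDist T y x := by
  simp only [chainDist, eq_comm]

theorem chainDist_le_max (x y z : T.V) :
    chainDist T x z ≤ max (chainDist T x y) (chainDist T y z) := by
  by_contra! h
  obtain ⟨h₁, h₂⟩ := max_lt_iff.1 h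
  obtain ⟨m, hm, hm'⟩ := exists_of_chainDist_lt T h₁
  obtain ⟨n, hn, hn'⟩ := exists_of_chainDist_lt T h₂
  rcases le_total m n with hmn | hmn
  · exact absurd (chainDist_le T (hm.trans (proj_eq_of_le T hmn hn))) hm'.not_ge
  · exact absurd (chainDist_le T ((proj_eq_of_le T hmn hm).trans hn)) hn'.not_ge

theorem chainDist_smul_smul (k : FinPerm V) (x y : T.V) :
    chainDist T (k • x) (k • y) = chainDist T x y := by
  simp only [chainDist, map_smul, smul_left_cancel_iff]

/-- The equivariant metric `chainDist` on a coalgebra that the final chain separates. -/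
noncomputable abbrev chainMetric (hT : ∀ x y : T.V, (∀ n, proj T n x = proj T n y) → x = y) :
    EquivariantMetric T.V where
  dist := chainDist T
  dist_self := chainDist_self T
  dist_comm := chainDist_comm T
  dist_triangle x y z := (chainDist_le_max T x y z).trans
    (max_le_add_of_nonneg (chainDist_nonneg T x y) (chainDist_nonneg T y z))
  eq_of_dist_eq_zero {x y} h := hT x y fun n =>
    proj_eq_of_chainDist_lt T (lt_of_eq_of_lt h (by positivity))
  dist_le_one x y := by simpa using chainDist_le T (n := 0) (x := x) (y := y) rfl
  dist_smul_smul := chainDist_smul_smul T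

/-- The equivariant metric induced by an injective morphism. -/
noncomputable abbrev inducedMetric {X Y : Nom.{u, v} V} [EquivariantMetric Y] (i : X ⟶ Y)
    (hi : Function.Injective i) : EquivariantMetric X where
  toMetricSpace := MetricSpace.induced i hi inferInstance
  dist_le_one x y := EquivariantMetric.dist_le_one (i x) (i y)
  dist_smul_smul k x y := by
    change dist (i (k • x)) (i (k • y)) = dist (i x) (i y)
    rw [map_smul, map_smul, EquivariantMetric.dist_smul_smul]

end ChainMetric

/-! ### Completeness of the final coalgebra and density of the initial algebra. -/

section Completion

variable {F : Nom.{u, v} V ⥤ Nom.{u, v} V}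

theorem isNominallyComplete_finalCoalgebra [Limits.PreservesLimitsOfShape ℕᵒᵖ F]
    [EquivariantMetric (finalCoalgebra F).V]
    (hd : ∀ x y : (finalCoalgebra F).V, dist x y = chainDist (finalCoalgebra F) x y) :
    IsNominallyComplete (finalCoalgebra F).V := by
  rintro x ⟨hx, S, hS⟩
  have hstab : ∀ n, ∃ N, ∀ k ≥ N, proj (finalCoalgebra F) n (x k) =
      proj (finalCoalgebra F) n (x N) := by
    intro n
    obtain ⟨N, hN⟩ := Metric.cauchySeq_iff'.1 hx ((1 / 2) ^ n) (by positivity)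
    exact ⟨N, fun k hk => proj_eq_of_chainDist_lt _ (hd _ _ ▸ hN k hk)⟩
  -- The limit collects the stable value at each level; the common support `S` is what makes this
  -- thread a point of `T`.
  choose N hN using hstab
  let y : seqLimit (chainMap F) :=
    ⟨fun n => proj (finalCoalgebra F) n (x (N n)), fun n => by
      change chainMap F n (proj (finalCoalgebra F) (n + 1) (x (N (n + 1)))) =
        proj (finalCoalgebra F) n (x (N n))
      -- Both stable values are read off at a single index past both thresholds.
      rw [← hN n (max (N n) (N (n + 1))) (le_max_left _ _),
        ← hN (n + 1) (max (N n) (N (n + 1))) (le_max_right _ _),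
        ← ConcreteCategory.comp_apply, proj_comp_chainMap],
      S, fun n => supports_map _ (hS _)⟩
  have hy : ∀ n, proj (finalCoalgebra F) n y = proj (finalCoalgebra F) n (x (N n)) := fun n =>
    congrArg (fun q : seqLimit (chainMap F) ⟶ finalChain F n => q y) (proj_finalCoalgebra F n)
  refine ⟨y, Metric.tendsto_atTop.2 fun ε hε => ?_⟩
  obtain ⟨n, hn⟩ := exists_pow_lt_of_lt_one hε (by norm_num : (1 / 2 : ℝ) < 1)
  refine ⟨N n, fun k hk => ?_⟩
  refine (hd _ _).trans_lt ?_
  exact (chainDist_le _ ((hN n k hk).trans (hy n).symm)).trans_lt hn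

/-- The morphisms `F^n 1 ⟶ A` into an algebra `A` induced by a morphism `1 ⟶ A`. -/
def chainSection {A : Nom.{u, v} V} (a : F.obj A ⟶ A) (e : one V ⟶ A) :
    (n : ℕ) → (finalChain F n ⟶ A)
  | 0 => e
  | n + 1 => F.map (chainSection a e n) ≫ a

theorem chainSection_comp_proj (T : Endofunctor.Coalgebra F) {A : Nom.{u, v} V} (a : F.obj A ⟶ A)
    (e : one V ⟶ A) (i : A ⟶ T.V) (hi : a ≫ i ≫ T.str = F.map i) (n : ℕ) :
    chainSection a e n ≫ i ≫ proj T n = 𝟙 _ := by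
  induction n with
  | zero => rfl
  | succ n ih =>
    change (F.map (chainSection a e n) ≫ a) ≫ i ≫ T.str ≫ F.map (proj T n) = 𝟙 _
    have h : a ≫ i ≫ T.str ≫ F.map (proj T n) = F.map i ≫ F.map (proj T n) := by
      rw [← hi, Category.assoc, Category.assoc]
    rw [Category.assoc, h, ← F.map_comp, ← F.map_comp, ih, F.map_id]

theorem isNominalCompletion_of_proj (T : Endofunctor.Coalgebra F) {A : Nom.{u, v} V}
    [EquivariantMetric T.V] [EquivariantMetric A]
    (hd : ∀ x y : T.V, dist x y = chainDist T x y) (hT : IsNominallyComplete T.V)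
    (a : F.obj A ⟶ A) (e : one V ⟶ A) (i : A ⟶ T.V) (hi : a ≫ i ≫ T.str = F.map i)
    (hiso : Isometry fun x : A => i x) : IsNominalCompletion i where
  isometry := hiso
  complete := hT
  exists_seq y := by
    have hproj : ∀ n, proj T n (i (chainSection a e n (proj T n y))) = proj T n y := fun n =>
      congrArg (fun q : finalChain F n ⟶ finalChain F n => q (proj T n y))
        (chainSection_comp_proj T a e i hi n)
    have hlim : Tendsto (fun n => i (chainSection a e n (proj T n y))) atTop (𝓝 y) := by
      refine Metric.tendsto_atTop.2 fun ε hε => ?_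
      obtain ⟨n, hn⟩ := exists_pow_lt_of_lt_one hε (by norm_num : (1 / 2 : ℝ) < 1)
      refine ⟨n, fun k hk => ?_⟩
      rw [hd]
      exact (chainDist_le T (proj_eq_of_le T hk (hproj k))).trans_lt hn
    obtain ⟨S, hS⟩ := T.V.finitely_supported y
    refine ⟨fun n => chainSection a e n (proj T n y), ⟨?_, S, fun n => ?_⟩, hlim⟩
    -- The images converge, hence are Cauchy, and the isometry reflects this.
    · exact (hiso.isUniformInducing.cauchy_map_iff).1 hlim.cauchySeq
    · exact supports_map _ (supports_map _ hS)

end Completion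

end Nom

theorem mainTheorem5 {V : Type u} [Countable V] [Infinite V]
    (F : Nom.{u, v} V ⥤ Nom.{u, v} V)
    [Limits.PreservesLimitsOfShape ℕᵒᵖ F] [F.PreservesMonomorphisms]
    (hs : Nonempty (Nom.one V ⟶ F.obj (Nom.zero V))) :
    ∃ (T : Endofunctor.Coalgebra F) (I : Endofunctor.Algebra F),
      Nonempty (Limits.IsTerminal T) ∧ Nonempty (Limits.IsInitial I) ∧
      ∃ (_ : Nom.EquivariantMetric T.V) (_ : Nom.EquivariantMetric I.a),
        (∀ x y : T.V, dist x y = Nom.chainDist T x y) ∧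
        ∃ i : I.a ⟶ T.V, I.str ≫ i ≫ T.str = F.map i ∧ Nom.IsNominalCompletion i := by
  obtain ⟨s⟩ := hs
  let T := Nom.finalCoalgebra F
  -- Lambek's lemma.
  have : IsIso T.str := Endofunctor.Coalgebra.Terminal.str_isIso (Nom.finalCoalgebraIsTerminal F)
  let m : F.obj T.V ⟶ T.V := inv T.str
  have hm : Function.Injective m := Nom.injective_of_mono m
  let i : Nom.sub (Nom.leastClosed m) ⟶ T.V := Nom.incl (Nom.leastClosed m)
  have hi : Nom.leastStr m ≫ i ≫ T.str = F.map i := by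
    rw [← Category.assoc, Nom.leastStr_comp_incl, Category.assoc, IsIso.inv_hom_id,
      Category.comp_id]
  let dT : Nom.EquivariantMetric T.V := Nom.chainMetric T fun x y h =>
    Nom.seqLimit_ext (Nom.chainMap F) fun n => by
      have h' := h n
      rw [Nom.proj_finalCoalgebra] at h'
      exact h'
  let dI : Nom.EquivariantMetric (Nom.sub (Nom.leastClosed m)) :=
    Nom.inducedMetric i (Nom.incl_injective _)
  have hd : ∀ x y : T.V, dist x y = Nom.chainDist T x y := fun _ _ => rfl
  exact ⟨T, Nom.leastAlgebra m, ⟨Nom.finalCoalgebraIsTerminal F⟩,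
    ⟨Nom.leastAlgebraIsInitial m hm⟩, dT, dI, hd, i, hi,
    Nom.isNominalCompletion_of_proj T hd (Nom.isNominallyComplete_finalCoalgebra hd)
      -- The point `1 ⟶ F 0 ⟶ F I ⟶ I` starts the sections.
      (Nom.leastStr m) (s ≫ F.map (Nom.fromZero _) ≫ Nom.leastStr m) i hi
      (Isometry.of_dist_eq fun _ _ => rfl)⟩
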